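/- For $n\in\mathbb{N}_0$ let $L_n(x)=\sum_{k=0}^n\binom{n}{n-k}\frac{(-x)^k}{k!}$ be the Laguerre polynomials, let $\phi_n(x)=e^{-x}L_n(2x)$ be the Laguerre functions, and for $N\in\mathbb{N}_0$ let $X_N$ be the complex linear span of $\phi_0,\dots,\phi_N$. For $\nu\in\mathbb{N}_0$ and $z\in\mathbb{C}\setminus\{0\}$ let $$h_\nu(z)=-\frac{i}{z}\,e^{iz}\,(-i)^\nu\sum_{m=0}^{\nu}\frac{i^m}{m!\,(2z)^m}\,\frac{(\nu+m)!}{(\nu-m)!}$$ be the spherical Hankel function of the first kind of index $\nu$. Theorem. Let $\nu\in\mathbb{N}_0$, let $R>0$, and let $\omega\in\mathbb{C}$ and $\sigma\in\mathbb{C}\setminus(-\infty,0]$ satisfy $\operatorname{Im}(\sigma\omega)>0$. Then there are constants $c_1,c_2>0$, which do not depend on $N$ (they may depend on $\nu,R,\omega,\sigma$), such that for every $N\in\mathbb{N}_0$ $$\inf_{u\in X_N}\left\|h_\nu(\omega(R+\sigma\,\cdot))-u\right\|_{L^2(\mathbb{R}_{\ge 0})}\le c_1\left|\frac{1+i\sigma\omega}{1-i\sigma\omega}\right|^{N+1}+c_2\exp\left(-2\operatorname{Re}\sqrt{\frac{2R(N+1)}{\sigma}}\right)(N+1)^{\nu/2},$$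 where $\sqrt{\cdot}$ denotes the principal square root. -/

import Mathlib

open MeasureTheory
open scoped Nat ENNReal

noncomputable section

/-- The Laguerre polynomial `L_n(x) = ∑_{k=0}^n binom(n, n-k) (-x)^k / k!`. -/
def laguerreL (n : ℕ) (x : ℝ) : ℝ :=
  ∑ k ∈ Finset.range (n + 1), (n.choose (n - k) : ℝ) * (-x) ^ k / (k ! : ℝ)

/-- The Laguerre function `φ_n(x) = exp(-x) L_n(2x)`, regarded as complex valued. -/
def laguerrePhi (n : ℕ) (x : ℝ) : ℂ :=
  ((Real.exp (-x) * laguerreL n (2 * x) : ℝ) : ℂ)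

/-- The space `X_N`: the complex span of the Laguerre functions `φ_0, …, φ_N`. -/
def laguerreSpace (N : ℕ) : Submodule ℂ (ℝ → ℂ) :=
  Submodule.span ℂ (laguerrePhi '' Set.Iic N)

/-- The spherical Hankel function of the first kind
`h_ν(z) = -(i/z) exp(iz) (-i)^ν ∑_{m=0}^ν i^m / (m! (2z)^m) * (ν+m)! / (ν-m)!`, for `z ≠ 0`. -/
def sphericalHankel (ν : ℕ) (z : ℂ) : ℂ :=
  -(Complex.I / z) * Complex.exp (Complex.I * z) *
    ((-Complex.I) ^ ν * ∑ m ∈ Finset.range (ν + 1),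
      Complex.I ^ m / ((m ! : ℂ) * (2 * z) ^ m) * (((ν + m)! : ℂ) / ((ν - m)! : ℂ)))

/-- The best-approximation error `inf_{u ∈ X_N} ‖f - u‖` in `L²(ℝ_{≥0})`, as an extended
nonnegative real. -/
def laguerreBestError (N : ℕ) (f : ℝ → ℂ) : ℝ≥0∞ :=
  ⨅ u ∈ laguerreSpace N, eLpNorm (fun x => f x - u x) 2 (volume.restrict (Set.Ici 0))

end

section LaplaceTransform

theorem integrableOn_pow_mul_cexp_neg_mul (m : ℕ) {z : ℂ} (hz : 0 < z.re) :
    IntegrableOn (fun x : ℝ => (x : ℂ) ^ m * Complex.exp (-z * x)) (Set.Ioi 0) := by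
  have h := integrableOn_rpow_mul_exp_neg_mul_rpow (p := 1) (s := m) (b := z.re)
    (by have : (0 : ℝ) ≤ m := m.cast_nonneg
        linarith) one_pos hz
  refine Integrable.mono h (Continuous.aestronglyMeasurable (by fun_prop)) ?_
  filter_upwards with x
  simp [Complex.norm_exp]

theorem integral_pow_mul_cexp_neg_mul (m : ℕ) {z : ℂ} (hz : 0 < z.re) :
    ∫ x : ℝ in Set.Ioi 0, (x : ℂ) ^ m * Complex.exp (-z * x) = m ! / z ^ (m + 1) := by
  have hz0 : z ≠ 0 := by rintro rfl; simp at hz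
  induction m with
  | zero =>
    simp only [pow_zero, one_mul]
    rw [integral_exp_mul_complex_Ioi (by simpa using hz)]
    simp
  | succ m ih =>
    have hd : ∀ x : ℝ, HasDerivAt (fun x : ℝ => (x : ℂ) ^ (m + 1) * Complex.exp (-z * x))
        ((m + 1 : ℂ) * ((x : ℂ) ^ m * Complex.exp (-z * x)) -
          z * ((x : ℂ) ^ (m + 1) * Complex.exp (-z * x))) x := by
      intro x
      have h1 : HasDerivAt (fun y : ℂ => y ^ (m + 1) * Complex.exp (-z * y))
        (((m + 1 : ℕ) * (x : ℂ) ^ m) * Complex.exp (-z * x) +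
          (x : ℂ) ^ (m + 1) * (Complex.exp (-z * x) * (-z * 1))) (x : ℂ) :=
        (hasDerivAt_pow (m + 1) (x : ℂ)).mul (((hasDerivAt_id (x : ℂ)).const_mul (-z)).cexp)
      convert! h1.comp_ofReal using 1
      push_cast; ring
    have hi0 := integrableOn_pow_mul_cexp_neg_mul m hz
    have hi1 := integrableOn_pow_mul_cexp_neg_mul (m + 1) hz
    have hlim : Filter.Tendsto (fun x : ℝ => (x : ℂ) ^ (m + 1) * Complex.exp (-z * x))
        Filter.atTop (nhds 0) := by
      rw [tendsto_zero_iff_norm_tendsto_zero]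
      have := tendsto_rpow_mul_exp_neg_mul_atTop_nhds_zero (m + 1 : ℕ) z.re hz
      refine (this.comp Filter.tendsto_id).congr' ?_
      filter_upwards [Filter.eventually_ge_atTop 0] with x hx
      simp [Complex.norm_exp, -Real.rpow_natCast, abs_of_nonneg hx]
      norm_cast
    have key := integral_Ioi_of_hasDerivAt_of_tendsto' (a := 0) (fun x _ => hd x)
      ((hi0.const_mul _).sub (hi1.const_mul _)) hlim
    rw [integral_sub (hi0.const_mul _) (hi1.const_mul _), integral_const_mul,
      integral_const_mul, ih] at key
    simp only [Complex.ofReal_zero, ne_eq, Nat.add_eq_zero_iff, one_ne_zero, and_false,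
      not_false_eq_true, zero_pow, zero_mul, sub_zero] at key
    apply mul_left_cancel₀ hz0
    rw [← sub_eq_zero.1 key, Nat.factorial_succ]
    push_cast
    field_simp
    ring

end LaplaceTransform

section Laguerre

theorem laguerrePhi_eq_sum (n : ℕ) (x : ℝ) :
    laguerrePhi n x = ∑ k ∈ Finset.range (n + 1),
      ((n.choose k : ℂ) * (-2) ^ k / k !) * ((x : ℂ) ^ k * Complex.exp (-1 * x)) := by
  unfold laguerrePhi laguerreL
  push_cast
  rw [Finset.mul_sum]
  refine Finset.sum_congr rfl fun k hk => ?_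
  rw [Nat.choose_symm (by simpa [Nat.lt_succ_iff] using hk), neg_mul_eq_neg_mul, mul_pow, neg_one_mul]
  ring

theorem continuous_laguerrePhi (n : ℕ) : Continuous (laguerrePhi n) := by
  rw [show laguerrePhi n = _ from funext (laguerrePhi_eq_sum n)]
  fun_prop

theorem conj_laguerrePhi (n : ℕ) (x : ℝ) :
    (starRingEnd ℂ) (laguerrePhi n x) = laguerrePhi n x := by
  simp [laguerrePhi, Complex.conj_ofReal, -Complex.ofReal_mul]

theorem cexp_mul_laguerrePhi (n : ℕ) (s : ℂ) (x : ℝ) :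
    Complex.exp (-s * x) * laguerrePhi n x = ∑ k ∈ Finset.range (n + 1),
      ((n.choose k : ℂ) * (-2) ^ k / k !) * ((x : ℂ) ^ k * Complex.exp (-(s + 1) * x)) := by
  rw [laguerrePhi_eq_sum, Finset.mul_sum]
  refine Finset.sum_congr rfl fun k _ => ?_
  rw [show -(s + 1) * (x : ℂ) = -s * x + -1 * x by ring, Complex.exp_add]
  ring

theorem integrableOn_cexp_mul_laguerrePhi (n : ℕ) {s : ℂ} (hs : 0 < s.re) :
    IntegrableOn (fun x : ℝ => Complex.exp (-s * x) * laguerrePhi n x) (Set.Ioi 0) := by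
  simp_rw [cexp_mul_laguerrePhi]
  exact integrable_finsetSum _ fun k _ =>
    (integrableOn_pow_mul_cexp_neg_mul k (z := s + 1) (by simp; linarith)).const_mul _

theorem integral_cexp_mul_laguerrePhi (n : ℕ) {s : ℂ} (hs : 0 < s.re) :
    ∫ x : ℝ in Set.Ioi 0, Complex.exp (-s * x) * laguerrePhi n x =
      ((s - 1) / (s + 1)) ^ n / (s + 1) := by
  have h1 : 0 < (s + 1).re := by simp; linarith
  have h0 : s + 1 ≠ 0 := by intro h; simp [h] at h1
  simp_rw [cexp_mul_laguerrePhi]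
  rw [integral_finsetSum _ fun k _ => (integrableOn_pow_mul_cexp_neg_mul k h1).const_mul _]
  simp_rw [integral_const_mul, integral_pow_mul_cexp_neg_mul _ h1]
  rw [show (s - 1) / (s + 1) = -2 / (s + 1) + 1 by field_simp; ring, add_pow, Finset.sum_div]
  refine Finset.sum_congr rfl fun k _ => ?_
  have : (k ! : ℂ) ≠ 0 := by exact_mod_cast k.factorial_ne_zero
  rw [one_pow, div_pow]
  field_simp
  ring

theorem sum_alternating_choose_mul_choose_add (m k : ℕ) :
    ∑ l ∈ Finset.range (m + 1), (-1 : ℤ) ^ l * m.choose l * (k + l).choose k =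
      (-1) ^ m * k.choose m := by
  have h := fwdDiff_iter_eq_sum_shift (h := (1 : ℕ)) (fun x : ℕ => ((x.choose k : ℕ) : ℤ)) m k
  have h2 : (fwdDiff (1 : ℕ))^[m] (fun x : ℕ => ((x.choose k : ℕ) : ℤ)) k = k.choose m := by
    rcases le_or_gt m k with hmk | hmk
    · obtain ⟨j, rfl⟩ := Nat.exists_eq_add_of_le hmk
      rw [fwdDiff_iter_choose, Nat.choose_symm_add]
    · obtain ⟨j, rfl⟩ := Nat.exists_eq_add_of_lt hmk
      rw [show k + j + 1 = (j + 1) + k by ring, Function.iterate_add_apply]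
      have := fwdDiff_iter_choose 0 k
      simp only [add_zero] at this
      rw [this, Nat.choose_eq_zero_of_lt (by omega)]
      have h0 : fwdDiff (1 : ℕ) (fun _ : ℕ => (0 : ℤ)) = fun _ => 0 := by
        funext y; simp [fwdDiff]
      have h1 : fwdDiff (1 : ℕ) (fun x : ℕ => ((x.choose 0 : ℕ) : ℤ)) = fun _ => 0 := by
        funext y; simp [fwdDiff]
      rw [Function.iterate_succ_apply, h1, Function.iterate_fixed h0]
      simp
  rw [h2] at h
  rw [h, Finset.mul_sum]
  refine Finset.sum_congr rfl fun l hl => ?_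
  have hl' : l ≤ m := by simpa [Nat.lt_succ_iff] using hl
  obtain ⟨j, rfl⟩ := Nat.exists_eq_add_of_le hl'
  have : (-1 : ℤ) ^ j * (-1) ^ j = 1 := by rw [← mul_pow]; simp
  simp only [smul_eq_mul, mul_one, pow_add, add_tsub_cancel_left]
  linear_combination -((-1 : ℤ) ^ l * (l + j).choose l * (k + l).choose k) * this

theorem sum_alternating_choose_mul_choose (n m : ℕ) :
    ∑ k ∈ Finset.range (n + 1), (-1 : ℤ) ^ k * n.choose k * k.choose m =
      if n = m then (-1) ^ n else 0 := by
  have h := fwdDiff_iter_eq_sum_shift (h := (1 : ℕ)) (fun x : ℕ => ((x.choose m : ℕ) : ℤ)) n 0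
  rw [fwdDiff_iter_choose_zero] at h
  have h2 : ∑ k ∈ Finset.range (n + 1), (-1 : ℤ) ^ k * n.choose k * k.choose m =
      (-1) ^ n * ∑ k ∈ Finset.range (n + 1), ((-1 : ℤ) ^ (n - k) * (n.choose k)) •
        (((0 + k • 1).choose m : ℕ) : ℤ) := by
    rw [Finset.mul_sum]
    refine Finset.sum_congr rfl fun l hl => ?_
    have hl' : l ≤ n := by simpa [Nat.lt_succ_iff] using hl
    obtain ⟨j, rfl⟩ := Nat.exists_eq_add_of_le hl'
    have : (-1 : ℤ) ^ j * (-1) ^ j = 1 := by rw [← mul_pow]; simp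
    simp only [smul_eq_mul, mul_one, pow_add, add_tsub_cancel_left, zero_add]
    linear_combination -((-1 : ℤ) ^ l * (l + j).choose l * l.choose m) * this
  rw [h2, ← h]
  split_ifs <;> simp

theorem laguerrePhi_mul_laguerrePhi (n m : ℕ) (x : ℝ) :
    laguerrePhi n x * laguerrePhi m x = ∑ k ∈ Finset.range (n + 1), ∑ l ∈ Finset.range (m + 1),
      ((n.choose k : ℂ) * (-2) ^ k / k ! * ((m.choose l : ℂ) * (-2) ^ l / l !)) *
        ((x : ℂ) ^ (k + l) * Complex.exp (-2 * x)) := by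
  rw [laguerrePhi_eq_sum, laguerrePhi_eq_sum, Finset.sum_mul_sum]
  refine Finset.sum_congr rfl fun k _ => Finset.sum_congr rfl fun l _ => ?_
  rw [show (-2 : ℂ) * (x : ℂ) = -1 * x + -1 * x by ring, Complex.exp_add]
  ring

theorem integrableOn_laguerrePhi_mul_laguerrePhi (n m : ℕ) :
    IntegrableOn (fun x : ℝ => laguerrePhi n x * laguerrePhi m x) (Set.Ioi 0) := by
  simp_rw [laguerrePhi_mul_laguerrePhi]
  exact integrable_finsetSum _ fun k _ => integrable_finsetSum _ fun l _ =>
    (integrableOn_pow_mul_cexp_neg_mul _ (z := 2) (by simp)).const_mul _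

theorem integral_laguerrePhi_mul_laguerrePhi (n m : ℕ) :
    ∫ x : ℝ in Set.Ioi 0, laguerrePhi n x * laguerrePhi m x = if n = m then 1 / 2 else 0 := by
  simp_rw [laguerrePhi_mul_laguerrePhi]
  have hi : ∀ k : ℕ, IntegrableOn (fun x : ℝ => (x : ℂ) ^ k * Complex.exp (-2 * x)) (Set.Ioi 0) :=
    fun k => integrableOn_pow_mul_cexp_neg_mul k (z := 2) (by simp)
  rw [integral_finsetSum _ fun k _ => integrable_finsetSum _ fun l _ => (hi _).const_mul _]
  simp_rw [integral_finsetSum _ fun l _ => (hi _).const_mul _, integral_const_mul,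
    integral_pow_mul_cexp_neg_mul _ (z := 2) (by simp : (0 : ℝ) < (2 : ℂ).re)]
  have h : ∀ k l : ℕ, ((n.choose k : ℂ) * (-2) ^ k / k ! * ((m.choose l : ℂ) * (-2) ^ l / l !)) *
      ((k + l)! / 2 ^ (k + l + 1)) = ((-1 : ℂ) ^ k * n.choose k / 2) *
        (((-1 : ℤ) ^ l * m.choose l * (k + l).choose k : ℤ) : ℂ) := by
    intro k l
    have h1 : (k ! : ℂ) ≠ 0 := by exact_mod_cast k.factorial_ne_zero
    have h2 : (l ! : ℂ) ≠ 0 := by exact_mod_cast l.factorial_ne_zero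
    have h3 : ((k + l)! : ℂ) = (k + l).choose k * k ! * l ! := by
      exact_mod_cast (Nat.choose_symm_add ▸ Nat.add_choose_mul_factorial_mul_factorial k l).symm
    rw [h3, show (-2 : ℂ) = -1 * 2 by ring, mul_pow, mul_pow]
    push_cast
    field_simp
    ring
  simp_rw [h, ← Finset.mul_sum, ← Int.cast_sum, sum_alternating_choose_mul_choose_add]
  have h4 : ∀ k : ℕ, (-1 : ℂ) ^ k * n.choose k / 2 * (((-1 : ℤ) ^ m * k.choose m : ℤ) : ℂ) =
      (-1 : ℂ) ^ m / 2 * (((-1 : ℤ) ^ k * n.choose k * k.choose m : ℤ) : ℂ) := by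
    intro k; push_cast; ring
  simp_rw [h4, ← Finset.mul_sum, ← Int.cast_sum, sum_alternating_choose_mul_choose]
  split_ifs with h
  · subst h
    have : (-1 : ℂ) ^ n * (-1) ^ n = 1 := by rw [← mul_pow]; simp
    push_cast
    linear_combination this / 2
  · simp

end Laguerre

section ExpRemainder

/-- The remainder of the Laguerre expansion of `ξ ↦ exp(-s ξ)` after `N` terms. -/
noncomputable def expLaguerreRemainder (N : ℕ) (s : ℂ) (x : ℝ) : ℂ :=
  Complex.exp (-s * x) -
    ∑ n ∈ Finset.range N, 2 * ((s - 1) / (s + 1)) ^ n / (s + 1) * laguerrePhi n x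

theorem expLaguerreRemainder_succ (N : ℕ) (s : ℂ) (x : ℝ) :
    expLaguerreRemainder (N + 1) s x = expLaguerreRemainder N s x -
      2 * ((s - 1) / (s + 1)) ^ N / (s + 1) * laguerrePhi N x := by
  simp [expLaguerreRemainder, Finset.sum_range_succ, sub_sub]

theorem integrableOn_expLaguerreRemainder_mul_laguerrePhi (N n : ℕ) {s : ℂ} (hs : 0 < s.re) :
    IntegrableOn (fun x => expLaguerreRemainder N s x * laguerrePhi n x) (Set.Ioi 0) := by
  simp_rw [expLaguerreRemainder, sub_mul, Finset.sum_mul, mul_assoc]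
  exact (integrableOn_cexp_mul_laguerrePhi n hs).sub (integrable_finsetSum _ fun k _ =>
    (integrableOn_laguerrePhi_mul_laguerrePhi k n).const_mul _)

theorem integral_expLaguerreRemainder_mul_laguerrePhi {N n : ℕ} (h : N ≤ n) {s : ℂ}
    (hs : 0 < s.re) :
    ∫ x in Set.Ioi 0, expLaguerreRemainder N s x * laguerrePhi n x =
      ((s - 1) / (s + 1)) ^ n / (s + 1) := by
  simp_rw [expLaguerreRemainder, sub_mul, Finset.sum_mul, mul_assoc]
  have hi := fun k => (integrableOn_laguerrePhi_mul_laguerrePhi k n).const_mul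
    (2 * ((s - 1) / (s + 1)) ^ k / (s + 1))
  rw [integral_sub (integrableOn_cexp_mul_laguerrePhi n hs) (integrable_finsetSum _ fun k _ => hi k),
    integral_finsetSum _ fun k _ => hi k, integral_cexp_mul_laguerrePhi n hs]
  simp_rw [integral_const_mul, integral_laguerrePhi_mul_laguerrePhi]
  rw [Finset.sum_eq_zero, sub_zero]
  intro k hk
  have : k ≠ n := by have := Finset.mem_range.1 hk; omega
  simp [this]

theorem norm_sq_cayley {s : ℂ} (hs : 0 < s.re) :
    ‖(s - 1) / (s + 1)‖ ^ 2 = 1 - 4 * s.re / ‖s + 1‖ ^ 2 := by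
  have h0 : s + 1 ≠ 0 := by
    intro h; have := congrArg Complex.re h; simp at this; linarith
  have h1 : ‖s + 1‖ ^ 2 ≠ 0 := by simpa using h0
  rw [norm_div, div_pow]
  rw [div_eq_iff h1, sub_mul, div_mul_cancel₀ _ h1, ← Complex.normSq_eq_norm_sq,
    ← Complex.normSq_eq_norm_sq, Complex.normSq_apply, Complex.normSq_apply]
  simp
  ring

theorem expLaguerreRemainder_mul_conj (N : ℕ) {s : ℂ} (hs : 0 < s.re) :
    IntegrableOn (fun x => expLaguerreRemainder N s x *
        (starRingEnd ℂ) (expLaguerreRemainder N s x)) (Set.Ioi 0) ∧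
      ∫ x in Set.Ioi 0, expLaguerreRemainder N s x *
        (starRingEnd ℂ) (expLaguerreRemainder N s x) =
          ((‖(s - 1) / (s + 1)‖ ^ (2 * N) / (2 * s.re) : ℝ) : ℂ) := by
  have h0 : s + 1 ≠ 0 := by
    intro h; have := congrArg Complex.re h; simp at this; linarith
  induction N with
  | zero =>
    have h : ∀ x : ℝ, expLaguerreRemainder 0 s x *
        (starRingEnd ℂ) (expLaguerreRemainder 0 s x) =
          (x : ℂ) ^ 0 * Complex.exp (-((2 * s.re : ℝ) : ℂ) * x) := by
      intro x
      simp only [expLaguerreRemainder, Finset.range_zero, Finset.sum_empty, sub_zero, pow_zero,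
        one_mul, ← Complex.exp_conj, ← Complex.exp_add, map_mul, map_neg, Complex.conj_ofReal]
      rw [← Complex.add_conj s]
      ring_nf
    have h2 : 0 < ((2 * s.re : ℝ) : ℂ).re := by rw [Complex.ofReal_re]; linarith
    simp_rw [h]
    refine ⟨integrableOn_pow_mul_cexp_neg_mul 0 h2, ?_⟩
    rw [integral_pow_mul_cexp_neg_mul 0 h2]
    simp
  | succ N ih =>
    set c : ℂ := 2 * ((s - 1) / (s + 1)) ^ N / (s + 1) with hc
    have h : ∀ x : ℝ, expLaguerreRemainder (N + 1) s x *
        (starRingEnd ℂ) (expLaguerreRemainder (N + 1) s x) =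
          expLaguerreRemainder N s x * (starRingEnd ℂ) (expLaguerreRemainder N s x) -
          (starRingEnd ℂ) c * (expLaguerreRemainder N s x * laguerrePhi N x) -
          c * (starRingEnd ℂ) (expLaguerreRemainder N s x * laguerrePhi N x) +
          c * (starRingEnd ℂ) c * (laguerrePhi N x * laguerrePhi N x) := by
      intro x
      rw [expLaguerreRemainder_succ, ← hc]
      simp only [map_sub, map_mul, conj_laguerrePhi]
      ring
    have i1 := integrableOn_expLaguerreRemainder_mul_laguerrePhi N N hs
    have i2 : IntegrableOn (fun x => (starRingEnd ℂ)
        (expLaguerreRemainder N s x * laguerrePhi N x)) (Set.Ioi 0) :=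
      Complex.conjCLE.toContinuousLinearMap.integrable_comp i1
    have i3 := integrableOn_laguerrePhi_mul_laguerrePhi N N
    have j1 : IntegrableOn (fun x => expLaguerreRemainder N s x *
        (starRingEnd ℂ) (expLaguerreRemainder N s x) -
        (starRingEnd ℂ) c * (expLaguerreRemainder N s x * laguerrePhi N x)) (Set.Ioi 0) :=
      ih.1.sub (i1.const_mul ((starRingEnd ℂ) c))
    have j2 : IntegrableOn (fun x => expLaguerreRemainder N s x *
        (starRingEnd ℂ) (expLaguerreRemainder N s x) -
        (starRingEnd ℂ) c * (expLaguerreRemainder N s x * laguerrePhi N x) -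
        c * (starRingEnd ℂ) (expLaguerreRemainder N s x * laguerrePhi N x)) (Set.Ioi 0) :=
      j1.sub (i2.const_mul c)
    have j3 := i3.const_mul (c * (starRingEnd ℂ) c)
    simp_rw [h]
    refine ⟨j2.add j3, ?_⟩
    rw [integral_add j2 j3, integral_sub j1 (i2.const_mul c), integral_sub ih.1 (i1.const_mul ((starRingEnd ℂ) c)),
      integral_const_mul, integral_const_mul, integral_const_mul, integral_conj, ih.2,
      integral_expLaguerreRemainder_mul_laguerrePhi le_rfl hs,
      integral_laguerrePhi_mul_laguerrePhi, if_pos rfl]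
    have hc2 : ((s - 1) / (s + 1)) ^ N / (s + 1) = c / 2 := by rw [hc]; ring
    have hcc : c * (starRingEnd ℂ) c =
        ((4 * ‖(s - 1) / (s + 1)‖ ^ (2 * N) / ‖s + 1‖ ^ 2 : ℝ) : ℂ) := by
      rw [Complex.mul_conj, Complex.normSq_eq_norm_sq, hc]
      simp only [norm_mul, norm_div, norm_pow, Complex.norm_ofNat]
      congr 1
      rw [pow_mul']
      ring
    have hc3 : (starRingEnd ℂ) (c / 2) = (starRingEnd ℂ) c / 2 := by
      generalize c = d
      rw [map_div₀, map_ofNat]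
    rw [hc2, hc3]
    clear_value c
    have hreal : ‖(s - 1) / (s + 1)‖ ^ (2 * (N + 1)) / (2 * s.re) =
        ‖(s - 1) / (s + 1)‖ ^ (2 * N) / (2 * s.re) -
          4 * ‖(s - 1) / (s + 1)‖ ^ (2 * N) / ‖s + 1‖ ^ 2 / 2 := by
      rw [mul_add, pow_add, mul_one, norm_sq_cayley hs]
      have : ‖s + 1‖ ≠ 0 := by simpa using h0
      field_simp
    rw [hreal, Complex.ofReal_sub, Complex.ofReal_div _ 2, ← hcc]
    push_cast
    ring

theorem lintegral_enorm_expLaguerreRemainder_sq (N : ℕ) {s : ℂ} (hs : 0 < s.re) :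
    ∫⁻ x in Set.Ioi 0, ‖expLaguerreRemainder N s x‖ₑ ^ 2 =
      ENNReal.ofReal (‖(s - 1) / (s + 1)‖ ^ (2 * N) / (2 * s.re)) := by
  obtain ⟨h1, h2⟩ := expLaguerreRemainder_mul_conj N hs
  simp_rw [Complex.mul_conj, Complex.normSq_eq_norm_sq] at h1 h2
  have h3 : IntegrableOn (fun x => ‖expLaguerreRemainder N s x‖ ^ 2) (Set.Ioi 0) := by
    have := h1.re
    simp only [RCLike.re_to_complex, Complex.ofReal_re] at this
    exact this
  rw [integral_complex_ofReal, Complex.ofReal_inj] at h2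
  rw [← h2, ofReal_integral_eq_lintegral_ofReal h3 (by filter_upwards with x; positivity)]
  refine lintegral_congr fun x => ?_
  rw [ENNReal.ofReal_pow (norm_nonneg _), ofReal_norm]

end ExpRemainder

section Minkowski

theorem lintegral_mul_sq_le {α : Type*} [MeasurableSpace α] {μ : Measure α} {f g : α → ℝ≥0∞}
    (hf : AEMeasurable f μ) (hg : AEMeasurable g μ) :
    (∫⁻ x, f x * g x ∂μ) ^ 2 ≤ (∫⁻ x, f x ^ 2 ∂μ) * ∫⁻ x, g x ^ 2 ∂μ := by
  have h := ENNReal.lintegral_mul_le_Lp_mul_Lq μ Real.HolderConjugate.two_two hf hg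
  calc (∫⁻ x, f x * g x ∂μ) ^ 2 ≤ ((∫⁻ a, f a ^ (2 : ℝ) ∂μ) ^ (1 / 2 : ℝ) *
        (∫⁻ a, g a ^ (2 : ℝ) ∂μ) ^ (1 / 2 : ℝ)) ^ 2 := by gcongr; exact h
    _ = _ := by
      rw [mul_pow, ← ENNReal.rpow_natCast, ← ENNReal.rpow_natCast, ← ENNReal.rpow_mul,
        ← ENNReal.rpow_mul]
      norm_num

/-- Minkowski's integral inequality in `L²`, with a pointwise majorant `e` of the `L²` norms. -/
theorem lintegral_lintegral_mul_sq_le {α β : Type*} [MeasurableSpace α] [MeasurableSpace β]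
    {μ : Measure α} {ν : Measure β} [SFinite μ] [SFinite ν] {g e : α → ℝ≥0∞} {K : α → β → ℝ≥0∞}
    (hg : Measurable g) (he : Measurable e) (hK : Measurable (Function.uncurry K))
    (he0 : ∀ x, e x ≠ 0) (he1 : ∀ x, e x ≠ ∞)
    (h : ∀ᵐ x ∂μ, ∫⁻ y, K x y ^ 2 ∂ν ≤ e x ^ 2) :
    ∫⁻ y, (∫⁻ x, g x * K x y ∂μ) ^ 2 ∂ν ≤ (∫⁻ x, g x * e x ∂μ) ^ 2 := by
  have hKy : ∀ y, Measurable fun x => K x y := fun y => hK.comp (measurable_id.prodMk measurable_const)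
  have hKx : ∀ x, Measurable fun y => K x y := fun x => hK.comp (measurable_const.prodMk measurable_id)
  have hsq : ∀ a : ℝ≥0∞, (a ^ (1 / 2 : ℝ)) ^ 2 = a := fun a => by
    rw [← ENNReal.rpow_natCast, ← ENNReal.rpow_mul]; norm_num
  have step : ∀ y, (∫⁻ x, g x * K x y ∂μ) ^ 2 ≤
      (∫⁻ x, g x * e x ∂μ) * ∫⁻ x, g x * (e x)⁻¹ * K x y ^ 2 ∂μ := by
    intro y
    have h1 : ∀ x, g x * K x y =
        (g x * e x) ^ (1 / 2 : ℝ) * ((g x * (e x)⁻¹) ^ (1 / 2 : ℝ) * K x y) := by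
      intro x
      rw [← mul_assoc, ← ENNReal.mul_rpow_of_nonneg _ _ (by norm_num),
        show g x * e x * (g x * (e x)⁻¹) = g x ^ 2 * (e x * (e x)⁻¹) by ring,
        ENNReal.mul_inv_cancel (he0 x) (he1 x), mul_one, ← ENNReal.rpow_natCast,
        ← ENNReal.rpow_mul]
      norm_num
    simp_rw [h1]
    refine (lintegral_mul_sq_le (f := fun x => (g x * e x) ^ (1 / 2 : ℝ))
      (g := fun x => (g x * (e x)⁻¹) ^ (1 / 2 : ℝ) * K x y) ((hg.mul he).pow_const _).aemeasurable
      (((hg.mul he.inv).pow_const _).mul (hKy y)).aemeasurable).trans_eq ?_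
    simp only [mul_pow, hsq]
  calc ∫⁻ y, (∫⁻ x, g x * K x y ∂μ) ^ 2 ∂ν
      ≤ ∫⁻ y, (∫⁻ x, g x * e x ∂μ) * ∫⁻ x, g x * (e x)⁻¹ * K x y ^ 2 ∂μ ∂ν :=
        lintegral_mono step
    _ = (∫⁻ x, g x * e x ∂μ) * ∫⁻ x, ∫⁻ y, g x * (e x)⁻¹ * K x y ^ 2 ∂ν ∂μ := by
        have hm : Measurable (Function.uncurry fun y x => g x * (e x)⁻¹ * K x y ^ 2) :=
          ((hg.mul he.inv).comp measurable_snd).mul ((hK.comp measurable_swap).pow_const 2)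
        rw [lintegral_const_mul _ (f := fun y => ∫⁻ x, g x * (e x)⁻¹ * K x y ^ 2 ∂μ)
          hm.lintegral_prod_right', lintegral_lintegral_swap hm.aemeasurable]
    _ ≤ (∫⁻ x, g x * e x ∂μ) * ∫⁻ x, g x * e x ∂μ := by
        refine mul_le_mul_right ?_ _
        refine lintegral_mono_ae (h.mono fun x hx => ?_)
        rw [lintegral_const_mul _ ((hKx x).pow_const 2)]
        calc g x * (e x)⁻¹ * ∫⁻ y, K x y ^ 2 ∂ν ≤ g x * (e x)⁻¹ * e x ^ 2 := by gcongr
          _ = g x * e x * (e x * (e x)⁻¹) := by ring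
          _ = g x * e x := by rw [ENNReal.mul_inv_cancel (he0 x) (he1 x), mul_one]
    _ = _ := (sq _).symm

end Minkowski

section BestError

theorem norm_cayley_le_one {s : ℂ} (hs : 0 < s.re) : ‖(s - 1) / (s + 1)‖ ≤ 1 := by
  have h := norm_sq_cayley hs
  have : 0 ≤ 4 * s.re / ‖s + 1‖ ^ 2 := by positivity
  exact (sq_le_one_iff₀ (norm_nonneg _)).1 (by linarith)

theorem one_le_norm_add_one {s : ℂ} (hs : 0 < s.re) : 1 ≤ ‖s + 1‖ := by
  have := Complex.re_le_norm (s + 1)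
  simp at this
  linarith

theorem measurable_expLaguerreRemainder (N : ℕ) :
    Measurable (Function.uncurry (expLaguerreRemainder N)) := by
  have h : Function.uncurry (expLaguerreRemainder N) = fun p : ℂ × ℝ =>
      Complex.exp (-p.1 * p.2) - ∑ n ∈ Finset.range N,
        2 * ((p.1 - 1) / (p.1 + 1)) ^ n / (p.1 + 1) * laguerrePhi n p.2 := rfl
  rw [h]
  have hphi : ∀ n, Measurable (laguerrePhi n) := fun n => (continuous_laguerrePhi n).measurable
  fun_prop

theorem laguerreBestError_le_of_laplace (N : ℕ) {G : ℝ → ℂ} (hG : Continuous G)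
    (hGi : IntegrableOn G (Set.Ioi 0)) {s : ℝ → ℂ} (hs : Continuous s)
    (hs0 : ∀ r, 0 < r → 0 < (s r).re) {f : ℝ → ℂ}
    (hf : ∀ x, 0 < x → f x = ∫ r in Set.Ioi (0 : ℝ), G r * Complex.exp (-s r * x))
    {e : ℝ → ℝ} (he : Continuous e) (he0 : ∀ r, 0 < e r)
    (h : ∀ r, 0 < r → ‖(s r - 1) / (s r + 1)‖ ^ (2 * (N + 1)) / (2 * (s r).re) ≤ e r ^ 2) :
    laguerreBestError N f ≤ ∫⁻ r in Set.Ioi 0, ‖G r‖ₑ * ENNReal.ofReal (e r) := by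
  set c : ℕ → ℝ → ℂ := fun n r => 2 * ((s r - 1) / (s r + 1)) ^ n / (s r + 1) with hc
  have hsm := hs.measurable
  have hcm : ∀ n, Measurable (c n) := fun n => by fun_prop
  have hci : ∀ n, IntegrableOn (fun r => G r * c n r) (Set.Ioi 0) := by
    intro n
    refine Integrable.mul_bdd (c := 2) hGi (hcm n).aestronglyMeasurable ?_
    filter_upwards [ae_restrict_mem measurableSet_Ioi] with r hr
    have h1 := norm_cayley_le_one (hs0 r hr)
    have h2 := one_le_norm_add_one (hs0 r hr)
    simp only [hc]
    rw [norm_div, norm_mul, norm_pow, Complex.norm_ofNat, div_le_iff₀ (by linarith)]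
    have := pow_le_one₀ (n := n) (norm_nonneg _) h1
    linarith
  have hei : ∀ x : ℝ, 0 < x →
      IntegrableOn (fun r => G r * Complex.exp (-s r * x)) (Set.Ioi 0) := by
    intro x hx
    refine Integrable.mul_bdd (c := 1) hGi
      (Continuous.aestronglyMeasurable (by fun_prop)) ?_
    filter_upwards [ae_restrict_mem measurableSet_Ioi] with r hr
    rw [Complex.norm_exp, Real.exp_le_one_iff]
    have := mul_pos (hs0 r hr) hx
    simp
    linarith
  set u : ℝ → ℂ := ∑ n ∈ Finset.range (N + 1),
    (∫ r in Set.Ioi (0 : ℝ), G r * c n r) • laguerrePhi n with hu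
  have hmem : u ∈ laguerreSpace N := Submodule.sum_mem _ fun n hn =>
    Submodule.smul_mem _ _ (Submodule.subset_span
      ⟨n, by simpa [Nat.lt_succ_iff] using hn, rfl⟩)
  have hdiff : ∀ x, 0 < x → f x - u x =
      ∫ r in Set.Ioi (0 : ℝ), G r * expLaguerreRemainder (N + 1) (s r) x := by
    intro x hx
    have : ∀ r : ℝ, G r * expLaguerreRemainder (N + 1) (s r) x =
        G r * Complex.exp (-s r * x) - ∑ n ∈ Finset.range (N + 1), G r * c n r * laguerrePhi n x := by
      intro r
      simp only [expLaguerreRemainder, mul_sub, Finset.mul_sum, hc, mul_assoc]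
    simp_rw [this]
    rw [integral_sub (hei x hx) (integrable_finsetSum _ fun n _ => (hci n).mul_const _),
      integral_finsetSum _ fun n _ => (hci n).mul_const _, hf x hx, hu]
    simp [integral_mul_const]
  refine (iInf₂_le u hmem).trans ?_
  have hmink := lintegral_lintegral_mul_sq_le (μ := volume.restrict (Set.Ioi (0 : ℝ)))
    (ν := volume.restrict (Set.Ioi (0 : ℝ)))
    (g := fun r => ‖G r‖ₑ) (e := fun r => ENNReal.ofReal (e r))
    (K := fun r x => ‖expLaguerreRemainder (N + 1) (s r) x‖ₑ)
    hG.measurable.enorm he.measurable.ennreal_ofReal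
    ((measurable_expLaguerreRemainder (N + 1)).comp
      ((hsm.comp measurable_fst).prodMk measurable_snd)).enorm
    (fun r => by simpa using he0 r) (fun r => ENNReal.ofReal_ne_top) (by
      filter_upwards [ae_restrict_mem measurableSet_Ioi] with r hr
      rw [lintegral_enorm_expLaguerreRemainder_sq _ (hs0 r hr), ← ENNReal.ofReal_pow (he0 r).le]
      exact ENNReal.ofReal_le_ofReal (h r hr))
  rw [← restrict_Ioi_eq_restrict_Ici, eLpNorm_eq_lintegral_rpow_enorm_toReal two_ne_zero ENNReal.ofNat_ne_top]
  have hle : ∫⁻ x in Set.Ioi (0 : ℝ), ‖f x - u x‖ₑ ^ (2 : ℝ) ≤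
      (∫⁻ r in Set.Ioi 0, ‖G r‖ₑ * ENNReal.ofReal (e r)) ^ 2 := by
    refine le_trans ?_ hmink
    refine setLIntegral_mono' measurableSet_Ioi fun x hx => ?_
    rw [ENNReal.rpow_two, hdiff x hx]
    gcongr
    refine (enorm_integral_le_lintegral_enorm _).trans_eq ?_
    simp_rw [enorm_mul]
  calc _ ≤ ((∫⁻ r in Set.Ioi 0, ‖G r‖ₑ * ENNReal.ofReal (e r)) ^ 2) ^ (1 / (2 : ℝ)) := by
        simp only [ENNReal.toReal_ofNat]
        gcongr
    _ = _ := by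
        rw [← ENNReal.rpow_two, ← ENNReal.rpow_mul]
        norm_num

end BestError

section BesselEstimate

theorem integrable_one_add_sq_pow_mul_exp (ν : ℕ) {a : ℝ} (ha : 0 < a) :
    Integrable fun z : ℝ => (1 + z ^ 2) ^ ν * Real.exp (-a * z ^ 2) := by
  simp_rw [add_comm (1 : ℝ), add_pow, one_pow, mul_one, Finset.sum_mul]
  refine integrable_finsetSum _ fun k _ => ?_
  have h := (integrable_rpow_mul_exp_neg_mul_sq ha (s := (2 * k : ℕ))
    (by have : (0 : ℝ) ≤ (2 * k : ℕ) := Nat.cast_nonneg _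
        linarith)).const_mul (ν.choose k : ℝ)
  refine h.congr (Filter.Eventually.of_forall fun z => ?_)
  simp only [Real.rpow_natCast, pow_mul]
  ring

theorem two_mul_add_sq_sub_le {y δ : ℝ} (hy : 0 < y) (hδ : 0 ≤ δ) :
    2 * δ ^ 2 + (y - δ) ^ 2 ≤ y ^ 2 + δ ^ 4 / y ^ 2 := by
  have hy2 : 0 < y ^ 2 := by positivity
  rw [← sub_nonneg]
  have : y ^ 2 + δ ^ 4 / y ^ 2 - (2 * δ ^ 2 + (y - δ) ^ 2) =
      (y - δ) ^ 2 * (2 * y * δ + δ ^ 2) / y ^ 2 := by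
    field_simp
    ring
  rw [this]
  positivity

theorem lintegral_comp_sqrt_add_le {b : ℝ} (hb : 0 < b) (F : ℝ → ℝ≥0∞) :
    ∫⁻ r in Set.Ioi (0 : ℝ), ENNReal.ofReal (1 / (2 * √(r + b))) * F (√(r + b)) ≤ ∫⁻ y, F y := by
  have h := lintegral_image_eq_lintegral_abs_deriv_mul (s := Set.Ioi (0 : ℝ))
    (f := fun r => √(r + b)) (f' := fun r => 1 / (2 * √(r + b))) measurableSet_Ioi
    (fun r hr => by
      have hr' : (0 : ℝ) < r := hr
      exact (((hasDerivAt_id r).add_const b).sqrt (by simp; positivity)).hasDerivWithinAt)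
    (fun x hx y hy hxy => by
      have hx' : (0 : ℝ) < x := hx
      have hy' : (0 : ℝ) < y := hy
      have := (Real.sqrt_inj (by positivity) (by positivity)).1 hxy
      linarith) F
  have habs : ∀ r : ℝ, |1 / (2 * √(r + b))| = 1 / (2 * √(r + b)) := fun r =>
    abs_of_nonneg (by positivity)
  simp_rw [habs] at h
  rw [← h]
  exact setLIntegral_le_lintegral _ _

theorem lintegral_shifted_gaussian_le (ν : ℕ) {a : ℝ} (ha : 0 < a) :
    ∃ M : ℝ, 0 < M ∧ ∀ δ : ℝ,
      ∫⁻ y : ℝ, ENNReal.ofReal ((1 + y ^ 2) ^ ν * Real.exp (-a * (y - δ) ^ 2)) ≤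
        ENNReal.ofReal (M * (1 + δ ^ 2) ^ ν) := by
  have hi := integrable_one_add_sq_pow_mul_exp ν ha
  have hnn : ∀ z : ℝ, 0 ≤ (1 + z ^ 2) ^ ν * Real.exp (-a * z ^ 2) := fun z => by positivity
  refine ⟨2 ^ ν * ((∫ z : ℝ, (1 + z ^ 2) ^ ν * Real.exp (-a * z ^ 2)) + 1), ?_, fun δ => ?_⟩
  · have : 0 ≤ ∫ z : ℝ, (1 + z ^ 2) ^ ν * Real.exp (-a * z ^ 2) :=
      integral_nonneg_of_ae (Filter.Eventually.of_forall hnn)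
    positivity
  rw [← lintegral_add_right_eq_self _ δ]
  calc ∫⁻ z : ℝ, ENNReal.ofReal ((1 + (z + δ) ^ 2) ^ ν * Real.exp (-a * (z + δ - δ) ^ 2))
      ≤ ∫⁻ z : ℝ, ENNReal.ofReal (2 ^ ν * (1 + δ ^ 2) ^ ν) *
          ENNReal.ofReal ((1 + z ^ 2) ^ ν * Real.exp (-a * z ^ 2)) := by
        refine lintegral_mono fun z => ?_
        rw [← ENNReal.ofReal_mul (by positivity)]
        refine ENNReal.ofReal_le_ofReal ?_
        rw [add_sub_cancel_right, ← mul_assoc, ← mul_pow, ← mul_pow]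
        gcongr
        nlinarith [sq_nonneg (z - δ), sq_nonneg (z * δ)]
    _ = ENNReal.ofReal (2 ^ ν * (1 + δ ^ 2) ^ ν *
          ∫ z : ℝ, (1 + z ^ 2) ^ ν * Real.exp (-a * z ^ 2)) := by
        rw [lintegral_const_mul _ (by fun_prop), ← ofReal_integral_eq_lintegral_ofReal hi
          (Filter.Eventually.of_forall hnn),
          ENNReal.ofReal_mul (p := 2 ^ ν * (1 + δ ^ 2) ^ ν) (by positivity)]
    _ ≤ _ := by
        refine ENNReal.ofReal_le_ofReal ?_
        have : 0 ≤ (2 : ℝ) ^ ν * (1 + δ ^ 2) ^ ν := by positivity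
        nlinarith

theorem exists_lintegral_exp_div_le (ν : ℕ) {a b p q γ : ℝ} (ha : 0 < a) (hb : 0 < b) (hp : 0 < p)
    (hq : 0 < q) (hγ : 0 < γ) :
    ∃ C : ℝ, 0 < C ∧ ∀ n : ℝ, 1 ≤ n →
      ∫⁻ r in Set.Ioi (0 : ℝ), ENNReal.ofReal ((1 + r) ^ ν * Real.exp (-a * r)) *
        ENNReal.ofReal (Real.exp (-(γ * n) / (|r| + b)) / √(2 * (q + p * |r|))) ≤
          ENNReal.ofReal (C * Real.exp (-2 * √(a * γ * n)) * n ^ ((ν : ℝ) / 2)) := by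
  obtain ⟨M, hM, hMb⟩ := lintegral_shifted_gaussian_le ν ha
  set k : ℝ := min (2 * q / b) (2 * p) with hk
  have hk0 : 0 < k := lt_min (by positivity) (by positivity)
  set C₁ : ℝ := Real.exp (a * b) * (2 / √k) with hC₁
  have hC₁0 : 0 < C₁ := by positivity
  refine ⟨C₁ * M * (1 + √(γ / a)) ^ ν, by positivity, fun n hn => ?_⟩
  have hn0 : 0 < n := by linarith
  set δ : ℝ := √(√(γ * n / a)) with hδ
  have hδ2 : δ ^ 2 = √(γ * n / a) := Real.sq_sqrt (Real.sqrt_nonneg _)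
  have hδ4 : a * δ ^ 4 = γ * n := by
    rw [show δ ^ 4 = (δ ^ 2) ^ 2 by ring, hδ2, Real.sq_sqrt (by positivity)]
    field_simp
  have haδ : a * δ ^ 2 = √(a * γ * n) := by
    rw [eq_comm, Real.sqrt_eq_iff_mul_self_eq (by positivity) (by positivity)]
    linear_combination -a * hδ4
  have hpt : ∀ r : ℝ, 0 < r → ENNReal.ofReal ((1 + r) ^ ν * Real.exp (-a * r)) *
      ENNReal.ofReal (Real.exp (-(γ * n) / (|r| + b)) / √(2 * (q + p * |r|))) ≤
      ENNReal.ofReal (C₁ * Real.exp (-2 * √(a * γ * n))) *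
        (ENNReal.ofReal (1 / (2 * √(r + b))) * ENNReal.ofReal
          ((1 + (√(r + b)) ^ 2) ^ ν * Real.exp (-a * (√(r + b) - δ) ^ 2))) := by
    intro r hr
    rw [abs_of_pos hr, ← ENNReal.ofReal_mul (by positivity), ← ENNReal.ofReal_mul (by positivity),
      ← ENNReal.ofReal_mul (by positivity)]
    refine ENNReal.ofReal_le_ofReal ?_
    have hx : 0 < r + b := by positivity
    set y : ℝ := √(r + b) with hy
    have hy0 : 0 < y := Real.sqrt_pos.2 hx
    have hy2 : y ^ 2 = r + b := Real.sq_sqrt hx.le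
    have h1 : (1 + r) ^ ν ≤ (1 + y ^ 2) ^ ν := by
      rw [hy2]
      gcongr
      linarith
    have h2 : Real.exp (-a * r) * Real.exp (-(γ * n) / (r + b)) ≤
        Real.exp (a * b) * Real.exp (-2 * √(a * γ * n)) * Real.exp (-a * (y - δ) ^ 2) := by
      rw [← Real.exp_add, ← Real.exp_add, ← Real.exp_add, Real.exp_le_exp, ← haδ, ← hδ4, ← hy2]
      have := mul_le_mul_of_nonneg_left (two_mul_add_sq_sub_le hy0 (Real.sqrt_nonneg _ : 0 ≤ δ)) ha.le
      have hr2 : r = y ^ 2 - b := by linarith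
      have h3 : -(a * δ ^ 4) / y ^ 2 = -(a * (δ ^ 4 / y ^ 2)) := by ring
      rw [h3, hr2]
      nlinarith
    have h3 : 1 / √(2 * (q + p * r)) ≤ (2 / √k) * (1 / (2 * y)) := by
      have : √k * y ≤ √(2 * (q + p * r)) := by
        rw [hy, ← Real.sqrt_mul hk0.le]
        apply Real.sqrt_le_sqrt
        have k1 : k * b ≤ 2 * q := by
          rw [← le_div_iff₀ hb]; exact min_le_left _ _
        have k2 : k ≤ 2 * p := min_le_right _ _
        nlinarith
      calc 1 / √(2 * (q + p * r)) ≤ 1 / (√k * y) :=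
            one_div_le_one_div_of_le (by positivity) this
        _ = _ := by field_simp
    calc (1 + r) ^ ν * Real.exp (-a * r) *
          (Real.exp (-(γ * n) / (r + b)) / √(2 * (q + p * r)))
        = (1 + r) ^ ν * (Real.exp (-a * r) * Real.exp (-(γ * n) / (r + b))) *
            (1 / √(2 * (q + p * r))) := by ring
      _ ≤ (1 + y ^ 2) ^ ν * (Real.exp (a * b) * Real.exp (-2 * √(a * γ * n)) *
            Real.exp (-a * (y - δ) ^ 2)) * ((2 / √k) * (1 / (2 * y))) := by gcongr
      _ = _ := by rw [hC₁]; ring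
  calc _ ≤ ∫⁻ r in Set.Ioi (0 : ℝ), ENNReal.ofReal (C₁ * Real.exp (-2 * √(a * γ * n))) *
        (ENNReal.ofReal (1 / (2 * √(r + b))) * ENNReal.ofReal
          ((1 + (√(r + b)) ^ 2) ^ ν * Real.exp (-a * (√(r + b) - δ) ^ 2))) :=
        setLIntegral_mono' measurableSet_Ioi hpt
    _ ≤ ENNReal.ofReal (C₁ * Real.exp (-2 * √(a * γ * n))) *
        ENNReal.ofReal (M * (1 + δ ^ 2) ^ ν) := by
        rw [lintegral_const_mul' _ _ ENNReal.ofReal_ne_top]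
        gcongr
        exact (lintegral_comp_sqrt_add_le hb fun y => ENNReal.ofReal
          ((1 + y ^ 2) ^ ν * Real.exp (-a * (y - δ) ^ 2))).trans (hMb δ)
    _ ≤ _ := by
        rw [← ENNReal.ofReal_mul (by positivity)]
        refine ENNReal.ofReal_le_ofReal ?_
        have h1 : 1 + δ ^ 2 ≤ (1 + √(γ / a)) * √n := by
          rw [hδ2, mul_div_right_comm, Real.sqrt_mul (by positivity)]
          have : 1 ≤ √n := Real.one_le_sqrt.2 hn
          linarith
        have h2 : (1 + δ ^ 2) ^ ν ≤ (1 + √(γ / a)) ^ ν * n ^ ((ν : ℝ) / 2) := by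
          calc (1 + δ ^ 2) ^ ν ≤ ((1 + √(γ / a)) * √n) ^ ν := by gcongr
            _ = _ := by
              rw [mul_pow, Real.sqrt_eq_rpow n, ← Real.rpow_mul_natCast hn0.le]
              ring_nf
        calc C₁ * Real.exp (-2 * √(a * γ * n)) * (M * (1 + δ ^ 2) ^ ν)
            ≤ C₁ * Real.exp (-2 * √(a * γ * n)) *
              (M * ((1 + √(γ / a)) ^ ν * n ^ ((ν : ℝ) / 2))) := by gcongr
          _ = _ := by ring

end BesselEstimate

section SphericalHankel

theorem exists_cayley_pow_le {s₀ g : ℂ} (hs₀ : 0 < s₀.re) (hg : 0 < g.re) :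
    ∃ b : ℝ, 0 < b ∧ ∀ (n : ℕ) (r : ℝ), 0 < r →
      ‖(s₀ + (starRingEnd ℂ) g * r - 1) / (s₀ + (starRingEnd ℂ) g * r + 1)‖ ^ (2 * n) /
          (2 * (s₀ + (starRingEnd ℂ) g * r).re) ≤
        (Real.exp (-(2 * g.re / ‖g‖ ^ 2 * n) / (|r| + b)) / √(2 * (s₀.re + g.re * |r|))) ^ 2 := by
  set d : ℝ := ‖s₀ + 1‖ with hd
  have hd1 : 1 ≤ d := one_le_norm_add_one hs₀
  have hg0 : 0 < ‖g‖ := norm_pos_iff.2 (by rintro rfl; simp at hg)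
  set b : ℝ := 2 * d / ‖g‖ + g.re * d ^ 2 / (‖g‖ ^ 2 * s₀.re) with hb
  have hb0 : 0 < b := by positivity
  refine ⟨b, hb0, fun n r hr => ?_⟩
  set s : ℂ := s₀ + (starRingEnd ℂ) g * r with hs
  have hre : s.re = s₀.re + g.re * r := by simp [hs]
  have hre0 : 0 < s.re := by rw [hre]; positivity
  have hns : 0 < ‖s + 1‖ := by have := one_le_norm_add_one hre0; linarith
  have hle : ‖s + 1‖ ≤ ‖g‖ * r + d := by
    calc ‖s + 1‖ = ‖(starRingEnd ℂ) g * r + (s₀ + 1)‖ := by rw [hs]; ring_nf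
      _ ≤ ‖(starRingEnd ℂ) g * r‖ + ‖s₀ + 1‖ := norm_add_le _ _
      _ = _ := by simp [hd, abs_of_pos hr]
  have hkey : g.re / (‖g‖ ^ 2 * (r + b)) ≤ s.re / ‖s + 1‖ ^ 2 := by
    rw [div_le_div_iff₀ (by positivity) (by positivity), hre]
    have h1 : ‖s + 1‖ ^ 2 ≤ (‖g‖ * r + d) ^ 2 := by gcongr
    have h2 : ‖g‖ ^ 2 * b = 2 * d * ‖g‖ + g.re * d ^ 2 / s₀.re := by
      rw [hb]; field_simp
    have h3 : (s₀.re + g.re * r) * (‖g‖ ^ 2 * (r + b)) = g.re * (‖g‖ * r + d) ^ 2 +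
        (s₀.re * ‖g‖ ^ 2 * r + 2 * d * ‖g‖ * s₀.re + g.re * r * (g.re * d ^ 2 / s₀.re)) := by
      rw [mul_add (‖g‖ ^ 2), h2]
      field_simp
      ring
    rw [h3]
    have h4 : 0 ≤ s₀.re * ‖g‖ ^ 2 * r + 2 * d * ‖g‖ * s₀.re +
      g.re * r * (g.re * d ^ 2 / s₀.re) := by positivity
    nlinarith
  rw [abs_of_pos hr, div_pow, Real.sq_sqrt (by positivity), ← hre, ← Real.exp_nat_mul, pow_mul,
    norm_sq_cayley hre0]
  gcongr ?_ / _
  have h0 : 0 ≤ 1 - 4 * s.re / ‖s + 1‖ ^ 2 := by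
    rw [← norm_sq_cayley hre0]; positivity
  calc (1 - 4 * s.re / ‖s + 1‖ ^ 2) ^ n ≤ (Real.exp (-(4 * s.re / ‖s + 1‖ ^ 2))) ^ n := by
        gcongr
        have := Real.add_one_le_exp (-(4 * s.re / ‖s + 1‖ ^ 2))
        linarith
    _ = Real.exp (n * -(4 * (s.re / ‖s + 1‖ ^ 2))) := by
        rw [← Real.exp_nat_mul, mul_div_assoc]
    _ ≤ Real.exp (n * -(4 * (g.re / (‖g‖ ^ 2 * (r + b))))) := by gcongr
    _ = _ := by
        congr 1
        push_cast
        field_simp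
        ring

/-- The density of the Laplace representation of `h_ν(ω (R + σ ·))` along the ray spanned by the
conjugate of `g`, where `g ^ 2 = σ⁻¹`. -/
noncomputable def hankelLaplaceDensity (ν : ℕ) (R : ℝ) (ω σ g : ℂ) (r : ℝ) : ℂ :=
  ∑ m ∈ Finset.range (ν + 1),
    Complex.exp (Complex.I * (ω * R)) * (-Complex.I) * (-Complex.I) ^ ν * Complex.I ^ m *
      (ν + m)! / ((ν - m)! * m ! * 2 ^ m) * ((starRingEnd ℂ) g / (ω * σ)) ^ (m + 1) / m ! *
        ((r : ℂ) ^ m * Complex.exp (-((starRingEnd ℂ) g * (R * g ^ 2)) * r))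

theorem conj_mul_sq_re (g : ℂ) (R : ℝ) :
    ((starRingEnd ℂ) g * (R * g ^ 2)).re = R * ‖g‖ ^ 2 * g.re := by
  have : (starRingEnd ℂ) g * (R * g ^ 2) = ((R * ‖g‖ ^ 2 : ℝ) : ℂ) * g := by
    rw [← Complex.normSq_eq_norm_sq, Complex.ofReal_mul, ← Complex.mul_conj]
    ring
  rw [this, Complex.re_ofReal_mul]

theorem continuous_hankelLaplaceDensity (ν : ℕ) (R : ℝ) (ω σ g : ℂ) :
    Continuous (hankelLaplaceDensity ν R ω σ g) := by
  unfold hankelLaplaceDensity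
  fun_prop

theorem integrableOn_hankelLaplaceDensity (ν : ℕ) {R : ℝ} (hR : 0 < R) (ω σ : ℂ) {g : ℂ}
    (hg : 0 < g.re) : IntegrableOn (hankelLaplaceDensity ν R ω σ g) (Set.Ioi 0) := by
  have hg0 : 0 < ‖g‖ := norm_pos_iff.2 (by rintro rfl; simp at hg)
  refine integrable_finsetSum _ fun m _ =>
    (integrableOn_pow_mul_cexp_neg_mul m ?_).const_mul _
  rw [conj_mul_sq_re]
  positivity

theorem exists_norm_hankelLaplaceDensity_le (ν : ℕ) (R : ℝ) (ω σ g : ℂ) :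
    ∃ D : ℝ, 0 < D ∧ ∀ r : ℝ, 0 < r → ‖hankelLaplaceDensity ν R ω σ g r‖ ≤
      D * ((1 + r) ^ ν * Real.exp (-(R * ‖g‖ ^ 2 * g.re) * r)) := by
  set d : ℕ → ℂ := fun m => Complex.exp (Complex.I * (ω * R)) * (-Complex.I) * (-Complex.I) ^ ν *
    Complex.I ^ m * (ν + m)! / ((ν - m)! * m ! * 2 ^ m) *
      ((starRingEnd ℂ) g / (ω * σ)) ^ (m + 1) / m ! with hd
  refine ⟨∑ m ∈ Finset.range (ν + 1), ‖d m‖ + 1, by positivity, fun r hr => ?_⟩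
  calc ‖hankelLaplaceDensity ν R ω σ g r‖
      ≤ ∑ m ∈ Finset.range (ν + 1),
          ‖d m‖ * ((1 + r) ^ ν * Real.exp (-(R * ‖g‖ ^ 2 * g.re) * r)) := by
        refine norm_sum_le_of_le _ fun m hm => ?_
        rw [norm_mul, norm_mul, Complex.norm_exp, norm_pow, Complex.norm_real,
          Real.norm_of_nonneg hr.le, ← conj_mul_sq_re g R]
        have h1 : r ^ m ≤ (1 + r) ^ ν := by
          calc r ^ m ≤ (1 + r) ^ m := by gcongr; linarith
            _ ≤ (1 + r) ^ ν := by
              gcongr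
              · linarith
              · simpa [Nat.lt_succ_iff] using hm
        have h2 : (-((starRingEnd ℂ) g * (R * g ^ 2)) * (r : ℂ)).re =
            -((starRingEnd ℂ) g * (R * g ^ 2)).re * r := by
          rw [Complex.re_mul_ofReal, Complex.neg_re]
        rw [h2]
        gcongr
    _ ≤ _ := by
        rw [← Finset.sum_mul]
        gcongr
        linarith

theorem sphericalHankel_eq_integral (ν : ℕ) {R : ℝ} (hR : 0 < R) {ω σ g : ℂ} (hσ : σ ≠ 0)
    (hω : ω ≠ 0) (hg : 0 < g.re) (hgσ : g ^ 2 = σ⁻¹) {x : ℝ} (hx : 0 < x) :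
    sphericalHankel ν (ω * (R + σ * x)) = ∫ r in Set.Ioi (0 : ℝ),
      hankelLaplaceDensity ν R ω σ g r *
        Complex.exp (-(-Complex.I * (σ * ω) + (starRingEnd ℂ) g * r) * x) := by
  have hg0 : g ≠ 0 := by rintro rfl; simp at hg
  have hgn : 0 < ‖g‖ := norm_pos_iff.2 hg0
  have hcg : (starRingEnd ℂ) g ≠ 0 := by simpa using hg0
  set w : ℂ := (starRingEnd ℂ) g * (R * g ^ 2 + x) with hw
  have hwre : 0 < w.re := by
    rw [hw, mul_add, Complex.add_re, conj_mul_sq_re, Complex.re_mul_ofReal, Complex.conj_re]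
    positivity
  have hw0 : w ≠ 0 := by intro h; simp [h] at hwre
  have hz : ω * (R + σ * x) = ω * σ / (starRingEnd ℂ) g * w := by
    rw [hw, hgσ]; field_simp
  have hint : ∀ r : ℝ, hankelLaplaceDensity ν R ω σ g r *
      Complex.exp (-(-Complex.I * (σ * ω) + (starRingEnd ℂ) g * r) * x) =
      ∑ m ∈ Finset.range (ν + 1),
        Complex.exp (Complex.I * (ω * (R + σ * x))) * (-Complex.I) * (-Complex.I) ^ ν *
          Complex.I ^ m * (ν + m)! / ((ν - m)! * m ! * 2 ^ m) *
            ((starRingEnd ℂ) g / (ω * σ)) ^ (m + 1) / m ! *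
              ((r : ℂ) ^ m * Complex.exp (-w * r)) := by
    intro r
    rw [hankelLaplaceDensity, Finset.sum_mul]
    refine Finset.sum_congr rfl fun m _ => ?_
    have he : Complex.exp (Complex.I * (ω * R)) *
        Complex.exp (-((starRingEnd ℂ) g * (R * g ^ 2)) * r) *
        Complex.exp (-(-Complex.I * (σ * ω) + (starRingEnd ℂ) g * r) * x) =
        Complex.exp (Complex.I * (ω * (R + σ * x))) * Complex.exp (-w * r) := by
      rw [← Complex.exp_add, ← Complex.exp_add, ← Complex.exp_add, hw]
      ring_nf
    linear_combination ((-Complex.I) * (-Complex.I) ^ ν *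
      Complex.I ^ m * (ν + m)! / ((ν - m)! * m ! * 2 ^ m) *
        ((starRingEnd ℂ) g / (ω * σ)) ^ (m + 1) / m ! * (r : ℂ) ^ m) * he
  simp_rw [hint]
  rw [integral_finsetSum _ fun m _ => (integrableOn_pow_mul_cexp_neg_mul m hwre).const_mul _]
  simp_rw [integral_const_mul, integral_pow_mul_cexp_neg_mul _ hwre]
  rw [sphericalHankel, Finset.mul_sum, Finset.mul_sum]
  refine Finset.sum_congr rfl fun m _ => ?_
  have h1 : (m ! : ℂ) ≠ 0 := by exact_mod_cast m.factorial_ne_zero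
  have h2 : ((ν - m)! : ℂ) ≠ 0 := by exact_mod_cast (ν - m).factorial_ne_zero
  have hz0 : ω * (R + σ * x) ≠ 0 := by
    rw [hz]; exact mul_ne_zero (div_ne_zero (mul_ne_zero hω hσ) hcg) hw0
  have h3 : ((starRingEnd ℂ) g / (ω * σ)) ^ (m + 1) / w ^ (m + 1) =
      1 / (ω * (R + σ * x)) ^ (m + 1) := by
    rw [hz, ← div_pow, ← one_div_pow]
    congr 1
    field_simp
  generalize ω * (R + σ * x) = z at *
  calc _ = Complex.exp (Complex.I * z) * (-Complex.I) * (-Complex.I) ^ ν *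
          Complex.I ^ m * (ν + m)! / ((ν - m)! * m ! * 2 ^ m) * (1 / z ^ (m + 1)) := by
        rw [mul_pow]
        field_simp
        ring
    _ = _ := by
        rw [← h3]
        field_simp

end SphericalHankel

section SquareRoot

theorem cpow_half_re_pos {z : ℂ} (hz : z ∈ Complex.slitPlane) :
    0 < (z ^ (1 / 2 : ℂ)).re := by
  obtain ⟨h1, h2⟩ := Complex.mem_slitPlane_iff_arg.1 hz
  rw [Complex.cpow_def_of_ne_zero h2, Complex.exp_re]
  refine mul_pos (Real.exp_pos _) (Real.cos_pos_of_mem_Ioo ?_)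
  have h3 : (Complex.log z * (1 / 2)).im = z.arg / 2 := by
    rw [show Complex.log z * (1 / 2) = ((1 / 2 : ℝ) : ℂ) * Complex.log z by push_cast; ring,
      Complex.im_ofReal_mul, Complex.log_im]
    ring
  rw [h3]
  have h4 := Complex.neg_pi_lt_arg z
  have h5 := lt_of_le_of_ne (Complex.arg_le_pi z) h1
  constructor <;> linarith

theorem ofReal_mul_cpow_half {r : ℝ} (hr : 0 < r) {z : ℂ} (hz : z ≠ 0) :
    ((r : ℂ) * z) ^ (1 / 2 : ℂ) = (√r : ℂ) * z ^ (1 / 2 : ℂ) := by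
  have hr0 : (r : ℂ) ≠ 0 := by exact_mod_cast hr.ne'
  rw [Complex.cpow_def_of_ne_zero (mul_ne_zero hr0 hz), Complex.cpow_def_of_ne_zero hz,
    Complex.log_ofReal_mul hr hz, add_mul, Complex.exp_add, Real.sqrt_eq_rpow,
    Real.rpow_def_of_pos hr]
  push_cast
  rfl

end SquareRoot

theorem mainTheorem2 (ν : ℕ) (R : ℝ) (hR : 0 < R) (ω σ : ℂ)
    (hσ : σ ∈ Complex.slitPlane) (hσω : 0 < (σ * ω).im) :
    ∃ c₁ c₂ : ℝ, 0 < c₁ ∧ 0 < c₂ ∧ ∀ N : ℕ,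
      laguerreBestError N (fun ξ : ℝ => sphericalHankel ν (ω * ((R : ℂ) + σ * (ξ : ℂ)))) ≤
        ENNReal.ofReal
          (c₁ * ‖(1 + Complex.I * σ * ω) / (1 - Complex.I * σ * ω)‖ ^ (N + 1) +
            c₂ * Real.exp (-2 * ((2 * (R : ℂ) * ((N : ℂ) + 1) / σ) ^ (1 / 2 : ℂ)).re) *
              ((N : ℝ) + 1) ^ ((ν : ℝ) / 2)) := by
  have hσ0 : σ ≠ 0 := by rintro rfl; simp at hσω
  have hω0 : ω ≠ 0 := by rintro rfl; simp at hσω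
  have hσi : σ⁻¹ ∈ Complex.slitPlane := by
    rw [Complex.mem_slitPlane_iff_arg] at hσ ⊢
    refine ⟨?_, inv_ne_zero hσ0⟩
    rw [Complex.arg_inv, if_neg hσ.1]
    have := Complex.neg_pi_lt_arg σ
    intro h
    linarith
  set g : ℂ := σ⁻¹ ^ (1 / 2 : ℂ) with hgdef
  have hg : 0 < g.re := cpow_half_re_pos hσi
  have hgn : 0 < ‖g‖ := norm_pos_iff.2 (by intro h; simp [h] at hg)
  have hgσ : g ^ 2 = σ⁻¹ := by
    rw [hgdef, ← Complex.cpow_nat_mul]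
    simp
  have hs₀ : 0 < (-Complex.I * (σ * ω)).re := by
    simpa [Complex.mul_re, Complex.mul_im] using hσω
  obtain ⟨b, hb, hcay⟩ := exists_cayley_pow_le hs₀ hg
  obtain ⟨D, hD, hDb⟩ := exists_norm_hankelLaplaceDensity_le ν R ω σ g
  have ha : 0 < R * ‖g‖ ^ 2 * g.re := by positivity
  have hγ : 0 < 2 * g.re / ‖g‖ ^ 2 := by positivity
  obtain ⟨C, hC, hCb⟩ := exists_lintegral_exp_div_le ν ha hb hg hs₀ hγ
  refine ⟨1, D * C, one_pos, by positivity, fun N => ?_⟩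
  have hroot : ((2 * (R : ℂ) * ((N : ℂ) + 1) / σ) ^ (1 / 2 : ℂ)).re =
      √(R * ‖g‖ ^ 2 * g.re * (2 * g.re / ‖g‖ ^ 2) * ((N + 1 : ℕ) : ℝ)) := by
    have h1 : 2 * (R : ℂ) * ((N : ℂ) + 1) / σ = ((2 * R * (N + 1) : ℝ) : ℂ) * σ⁻¹ := by
      push_cast; rw [div_eq_mul_inv]
    have h2 : R * ‖g‖ ^ 2 * g.re * (2 * g.re / ‖g‖ ^ 2) * ((N + 1 : ℕ) : ℝ) =
        2 * R * (N + 1) * g.re ^ 2 := by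
      push_cast; field_simp
    rw [h1, ofReal_mul_cpow_half (by positivity) (inv_ne_zero hσ0), Complex.re_ofReal_mul, h2,
      Real.sqrt_mul (x := 2 * R * (N + 1)) (by positivity), Real.sqrt_sq hg.le]
  refine (laguerreBestError_le_of_laplace N (continuous_hankelLaplaceDensity ν R ω σ g)
    (integrableOn_hankelLaplaceDensity ν hR ω σ hg)
    (s := fun r => -Complex.I * (σ * ω) + (starRingEnd ℂ) g * r) (by fun_prop)
    (fun r hr => ?_) (fun x hx => sphericalHankel_eq_integral ν hR hσ0 hω0 hg hgσ hx)
    (e := fun r => Real.exp (-(2 * g.re / ‖g‖ ^ 2 * (N + 1 : ℕ)) / (|r| + b)) /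
      √(2 * ((-Complex.I * (σ * ω)).re + g.re * |r|))) ?_ (fun r => ?_) (hcay (N + 1))).trans ?_
  · rw [Complex.add_re, Complex.re_mul_ofReal, Complex.conj_re]
    positivity
  · refine Continuous.div (Real.continuous_exp.comp (Continuous.div (by fun_prop) (by fun_prop)
      fun r => ?_)) (by fun_prop) fun r => ?_
    · positivity
    · exact (Real.sqrt_pos.2 (by positivity)).ne'
  · exact div_pos (Real.exp_pos _) (Real.sqrt_pos.2 (by positivity))
  · calc _ ≤ ∫⁻ r in Set.Ioi (0 : ℝ), ENNReal.ofReal D *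
          (ENNReal.ofReal ((1 + r) ^ ν * Real.exp (-(R * ‖g‖ ^ 2 * g.re) * r)) *
            ENNReal.ofReal (Real.exp (-(2 * g.re / ‖g‖ ^ 2 * (N + 1 : ℕ)) / (|r| + b)) /
              √(2 * ((-Complex.I * (σ * ω)).re + g.re * |r|)))) := by
          refine setLIntegral_mono' measurableSet_Ioi fun r hr => ?_
          rw [← mul_assoc (ENNReal.ofReal D), ← ENNReal.ofReal_mul hD.le, ← ofReal_norm]
          gcongr
          exact hDb r hr
      _ ≤ ENNReal.ofReal (D * (C * Real.exp (-2 * √(R * ‖g‖ ^ 2 * g.re * (2 * g.re / ‖g‖ ^ 2) *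
            ((N + 1 : ℕ) : ℝ))) * ((N + 1 : ℕ) : ℝ) ^ ((ν : ℝ) / 2))) := by
          rw [lintegral_const_mul' _ _ ENNReal.ofReal_ne_top, ENNReal.ofReal_mul hD.le]
          gcongr
          exact hCb _ (by push_cast; linarith [(N.cast_nonneg : (0 : ℝ) ≤ N)])
      _ ≤ _ := by
          refine ENNReal.ofReal_le_ofReal ?_
          rw [← hroot, Nat.cast_succ]
          have : 0 ≤ 1 * ‖(1 + Complex.I * σ * ω) / (1 - Complex.I * σ * ω)‖ ^ (N + 1) := by
            positivity
          linarith
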